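/- Let $n\ge 3$ and $m\ge 0$ be integers, $\rho>0$, and let $$p(\theta)=\rho+\sum_{k=0}^{m}\bigl(a_{kn+1}\cos((kn+1)\theta)+b_{kn+1}\sin((kn+1)\theta)+a_{kn-1}\cos((kn-1)\theta)+b_{kn-1}\sin((kn-1)\theta)\bigr)$$ be a trigonometric polynomial with real coefficients such that $p(\theta)+p''(\theta)\ge 0$ for all $\theta\in\mathbb R$. Let $\mathcal C\subset\mathbb R^2$ be the algebraic rotor of a regular $n$-gon with apothem $\rho$ that has $p$ as support function, that is, the curve $$\mathcal C=\bigl\{\bigl(p(\theta)\cos\theta-p'(\theta)\sin\theta,\ p(\theta)\sin\theta+p'(\theta)\cos\theta\bigr):\theta\in[-\pi,\pi]\bigr\}.$$ Assume that $\mathcal C$ is not a circle and that $a_{nm+1}\ne 0$ or $b_{nm+1}\ne 0$. Then $\mathcal C$ has a defining polynomial, i.e. an irreducible polynomial $f\in\mathbb R[x,y]$ such that the polynomials in $\mathbb R[x,y]$ vanishing on $\mathcal C$ are exactly the multiples of $f$ (so $f$ is unique up to a nonzero constant factor), and every such $f$ has total degree $2nm+4$ and satisfies $\deg_x f=\deg_y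 f=2nm+4$. -/

import Mathlib

open MvPolynomial

noncomputable section

/-- The map `θ ↦ γ(θ) = (p(θ) cos θ - p'(θ) sin θ, p(θ) sin θ + p'(θ) cos θ)`. -/
def supportParam (p : ℝ → ℝ) (θ : ℝ) : Fin 2 → ℝ :=
  ![p θ * Real.cos θ - deriv p θ * Real.sin θ,
    p θ * Real.sin θ + deriv p θ * Real.cos θ]

/-- The closed plane curve (as a set of points) described by `γ` on `[-π, π]`. -/
def supportCurve (p : ℝ → ℝ) : Set (Fin 2 → ℝ) :=
  supportParam p '' Set.Icc (-Real.pi) Real.pi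

/-- The trigonometric polynomial with constant term `ρ` and harmonics of order `k n ± 1`,
`0 ≤ k ≤ m`. The coefficient families are indexed by `ℤ` because the order `k n - 1` is `-1`
for `k = 0`; that term is just another harmonic of order one. -/
def rotorSupport (n m : ℕ) (ρ : ℝ) (a b : ℤ → ℝ) (θ : ℝ) : ℝ :=
  ρ + ∑ k ∈ Finset.range (m + 1),
    (a ((k : ℤ) * n + 1) * Real.cos (((k : ℝ) * n + 1) * θ)
      + b ((k : ℤ) * n + 1) * Real.sin (((k : ℝ) * n + 1) * θ)
      + a ((k : ℤ) * n - 1) * Real.cos (((k : ℝ) * n - 1) * θ)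
      + b ((k : ℤ) * n - 1) * Real.sin (((k : ℝ) * n - 1) * θ))

/-- `C` is an algebraic rotor of a regular `n`-gon with apothem `ρ`, with support function
`p = rotorSupport n m ρ a b`; the convexity condition is `p + p'' ≥ 0`. -/
structure IsAlgebraicRotor (n m : ℕ) (ρ : ℝ) (a b : ℤ → ℝ) (C : Set (Fin 2 → ℝ)) : Prop where
  three_le : 3 ≤ n
  apothem_pos : 0 < ρ
  curve_eq : C = supportCurve (rotorSupport n m ρ a b)
  convex : ∀ θ : ℝ,
    0 ≤ rotorSupport n m ρ a b θ + deriv (deriv (rotorSupport n m ρ a b)) θ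

/-- `C` is a Euclidean circle of positive radius. -/
def IsCircle (C : Set (Fin 2 → ℝ)) : Prop :=
  ∃ (c : Fin 2 → ℝ) (r : ℝ), 0 < r ∧
    C = {P : Fin 2 → ℝ | (P 0 - c 0) ^ 2 + (P 1 - c 1) ^ 2 = r ^ 2}

/-- `f` is a defining polynomial of the plane curve `C`: it is irreducible, and the
polynomials that vanish on `C` are exactly the multiples of `f`. The variables `x`, `y` are
`X 0`, `X 1`. -/
structure IsDefiningPolynomial (C : Set (Fin 2 → ℝ)) (f : MvPolynomial (Fin 2) ℝ) : Prop where
  irreducible : Irreducible f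
  vanishingIdeal_eq : vanishingIdeal ℝ C = Ideal.span {f}

end

/-!
In `z = exp (θ i)` the coordinates of the curve are Laurent polynomials with exponents from `-M` to
`M`, where `M = n m + 2` (for `m = 0` the curve is a circle), so a polynomial vanishes on the curve
exactly when this substitution kills it. The kernel is a prime ideal of height one, hence generated
by one irreducible `f`.

Substitution maps the polynomials of degree at most `d` into a space of dimension `2 d M + 1`.
Comparing this with the codimension of the multiples of `f`, which grows like `d deg f`, gives
`deg f ≤ 2 M`.

For the lower bound, the parametrization is birational. The gradient of `f` along the curve is
parallel to the normal direction `(cos θ, sin θ)`, so the ratio of its isotropic coordinates is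
`z ^ 2`; hence `z ^ 2` is a rational function of `x` and `y`. In `x + i y = e(z ^ 2) + z o(z ^ 2)`
the coefficient of `z` is `ρ`, so `o` is nonzero and `z` itself is a rational function of `x` and
`y`. Thus `ℂ(x, y) = ℂ(z)`, and the degree of `f` in `y` is `[ℂ(z) : ℂ(x)] = 2 M`.
-/

open LaurentPolynomial (T T_add T_apply T_zero eval₂ eval₂_C eval₂_T eval₂_toLaurent exists_T_pow
  isUnit_T)
open scoped LaurentPolynomial

theorem eq_span_singleton_of_prime_mem {R : Type*} [CommRing R] [IsDomain R]
    (hdim : ringKrullDim R ≤ 2) {I : Ideal R} [hI : I.IsPrime] (hmax : ¬ I.IsMaximal) {f : R}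
    (hf : Prime f) (hfI : f ∈ I) : I = Ideal.span {f} := by
  by_contra hne
  obtain ⟨J, hJ, hIJ⟩ := I.exists_le_maximal hI.ne_top
  have : (Ideal.span {f}).IsPrime := (Ideal.span_singleton_prime hf.ne_zero).2 hf
  have hlt₀ : (⊥ : PrimeSpectrum R) < ⟨Ideal.span {f}, this⟩ :=
    bot_lt_iff_ne_bot.2 fun h =>
      hf.ne_zero (Ideal.span_singleton_eq_bot.1 (congrArg PrimeSpectrum.asIdeal h))
  have hlt₁ : (⟨Ideal.span {f}, this⟩ : PrimeSpectrum R) < ⟨I, hI⟩ :=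
    lt_of_le_of_ne ((Ideal.span_singleton_le_iff_mem I).2 hfI)
      fun h => hne (congrArg PrimeSpectrum.asIdeal h).symm
  have hlt₂ : (⟨I, hI⟩ : PrimeSpectrum R) < ⟨J, hJ.isPrime⟩ :=
    lt_of_le_of_ne hIJ fun h => hmax (by rwa [show I = J from congrArg PrimeSpectrum.asIdeal h])
  let chain : LTSeries (PrimeSpectrum R) :=
    { length := 3
      toFun := ![⊥, ⟨Ideal.span {f}, this⟩, ⟨I, hI⟩, ⟨J, hJ.isPrime⟩]
      step := by
        intro i
        fin_cases i
        exacts [hlt₀, hlt₁, hlt₂] }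
  have hlen : ((3 : ℕ) : WithBot ℕ∞) ≤ 2 := (Order.LTSeries.length_le_krullDim chain).trans hdim
  exact absurd (by exact_mod_cast hlen : 3 ≤ 2) (by norm_num)

theorem exists_prime_eq_span_singleton {R : Type*} [CommRing R] [IsDomain R]
    [UniqueFactorizationMonoid R] (hdim : ringKrullDim R ≤ 2) {I : Ideal R} [hI : I.IsPrime]
    (hmax : ¬ I.IsMaximal) (hbot : I ≠ ⊥) : ∃ f, Prime f ∧ I = Ideal.span {f} := by
  obtain ⟨f, hfI, hf⟩ := hI.exists_mem_prime_of_ne_bot hbot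
  exact ⟨f, hf, eq_span_singleton_of_prime_mem hdim hmax hf hfI⟩

theorem finrank_eq_finrank_map_add_finrank_inf_ker {k V W : Type*} [Field k] [AddCommGroup V]
    [Module k V] [AddCommGroup W] [Module k W] (φ : V →ₗ[k] W) (S : Submodule k V)
    [FiniteDimensional k S] :
    Module.finrank k S
      = Module.finrank k (S.map φ) + Module.finrank k (S ⊓ LinearMap.ker φ : Submodule k V) := by
  rw [← LinearMap.finrank_range_add_finrank_ker (φ.domRestrict S), LinearMap.range_domRestrict,
    LinearMap.ker_domRestrict, ← Submodule.map_comap_subtype, Submodule.finrank_map_subtype_eq]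

theorem two_mul_finrank_restrictTotalDegree (k : Type*) [Field k] (d : ℕ) :
    2 * Module.finrank k (restrictTotalDegree (Fin 2) k d) = (d + 1) * (d + 2) := by
  have hcard : Module.finrank k (restrictTotalDegree (Fin 2) k d)
      = Nat.card {n : Fin 2 →₀ ℕ | (n.sum fun _ e => e) ≤ d} :=
    Module.finrank_eq_nat_card_basis (basisRestrictSupport k _)
  let e : {n : Fin 2 →₀ ℕ | (n.sum fun _ e => e) ≤ d} ≃
      (Finset.range (d + 1)).sigma fun s => Finset.HasAntidiagonal.antidiagonal s :=
    { toFun := fun n => ⟨⟨n.1 0 + n.1 1, (n.1 0, n.1 1)⟩, by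
        have := n.2
        simp only [implies_true, Finsupp.sum_fintype, Fin.sum_univ_two, Set.mem_ofPred_eq,
          Finset.mem_sigma, Finset.mem_range, Finset.HasAntidiagonal.mem_antidiagonal,
          and_true] at this ⊢
        omega⟩
      invFun := fun x => ⟨Finsupp.equivFunOnFinite.symm ![x.1.2.1, x.1.2.2], by
        obtain ⟨⟨s, a, b⟩, hx⟩ := x
        simp only [Finset.mem_sigma, Finset.mem_range, Finset.HasAntidiagonal.mem_antidiagonal,
          implies_true, Finsupp.sum_fintype, Fin.sum_univ_two, Set.mem_ofPred_eq,
          Finsupp.equivFunOnFinite_symm_apply_apply, Matrix.cons_val_zero, Matrix.cons_val_one]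
          at hx ⊢
        omega⟩
      left_inv := fun n => by
        ext i
        fin_cases i <;> simp
      right_inv := fun x => by
        obtain ⟨⟨s, a, b⟩, hx⟩ := x
        simp only [Finset.mem_sigma, Finset.HasAntidiagonal.mem_antidiagonal] at hx
        obtain ⟨-, rfl⟩ := hx
        simp }
  rw [hcard, Nat.card_congr e, Nat.card_eq_fintype_card, Fintype.card_coe, Finset.card_sigma]
  simp only [Finset.Nat.card_antidiagonal]
  have gauss := Finset.sum_range_id_mul_two (d + 2)
  rw [Finset.sum_range_succ', add_zero, Nat.add_succ_sub_one] at gauss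
  linarith

theorem exists_ne_zero_of_finrank_map_le {k V : Type*} [Field k] [AddCommGroup V] [Module k V]
    (φ : MvPolynomial (Fin 2) k →ₗ[k] V) (D : ℕ)
    (hφ : ∀ d, Module.finrank k ((restrictTotalDegree (Fin 2) k d).map φ) ≤ d * D + 1) :
    ∃ g, g ≠ 0 ∧ φ g = 0 := by
  by_contra! hinj
  have hker : LinearMap.ker φ = ⊥ :=
    (Submodule.eq_bot_iff _).2 fun g hg => by_contra fun h0 => hinj g h0 hg
  have hrank := finrank_eq_finrank_map_add_finrank_inf_ker φ
    (restrictTotalDegree (Fin 2) k (2 * D + 1))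
  rw [hker, inf_bot_eq, finrank_bot] at hrank
  nlinarith [two_mul_finrank_restrictTotalDegree k (2 * D + 1), hφ (2 * D + 1)]

theorem totalDegree_le_of_ker_dvd {k V : Type*} [Field k] [AddCommGroup V] [Module k V]
    (φ : MvPolynomial (Fin 2) k →ₗ[k] V) (D : ℕ)
    (hφ : ∀ d, Module.finrank k ((restrictTotalDegree (Fin 2) k d).map φ) ≤ d * D + 1)
    {f : MvPolynomial (Fin 2) k} (hf : f ≠ 0) (hker : ∀ g, φ g = 0 → f ∣ g) :
    f.totalDegree ≤ D := by
  set e := f.totalDegree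
  set t := e * D + 1 with ht
  have hle : restrictTotalDegree (Fin 2) k (e + t) ⊓ LinearMap.ker φ
      ≤ (restrictTotalDegree (Fin 2) k t).map (LinearMap.mulLeft k f) := by
    rintro g ⟨hg, hg0⟩
    obtain ⟨q, rfl⟩ := hker g hg0
    refine ⟨q, ?_, rfl⟩
    rcases eq_or_ne q 0 with rfl | hq
    · exact Submodule.zero_mem _
    · rw [SetLike.mem_coe, mem_restrictTotalDegree] at hg ⊢
      rw [totalDegree_mul_of_isDomain hf hq] at hg
      omega
  have hrank := finrank_eq_finrank_map_add_finrank_inf_ker φ (restrictTotalDegree (Fin 2) k (e + t))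
  have hmul := (Submodule.finrank_mono hle).trans (Submodule.finrank_map_le _ _)
  by_contra! hlt
  nlinarith [two_mul_finrank_restrictTotalDegree k (e + t),
    two_mul_finrank_restrictTotalDegree k t, hφ (e + t)]

open Classical in
theorem finrank_adjoin_image_compl_le_degreeOf {k K σ : Type*} [Field k] [Field K] [Algebra k K]
    {x : σ → K} {i : σ} (hx : AlgebraicIndependent k fun j : {j // j ≠ i} => x j)
    (hadj : IntermediateField.adjoin k (Set.range x) = ⊤) {h : MvPolynomial σ k} (h0 : h ≠ 0)
    (hh : aeval x h = 0) :
    Module.finrank (IntermediateField.adjoin k (x '' {i}ᶜ)) K ≤ degreeOf i h := by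
  set F := IntermediateField.adjoin k (x '' {i}ᶜ)
  let y : {j // j ≠ i} → F := fun j =>
    ⟨x j, IntermediateField.subset_adjoin k _ (Set.mem_image_of_mem x j.2)⟩
  have hy : AlgebraicIndependent k y := AlgebraicIndependent.of_comp F.val hx
  set h' := optionEquivLeft k {j // j ≠ i} (rename (Equiv.optionSubtypeNe i).symm h) with hh'
  set g : Polynomial F := h'.map (aeval y).toRingHom with hg
  have hg0 : g ≠ 0 := by
    rw [hg, Ne, Polynomial.map_eq_zero_iff hy, hh', EmbeddingLike.map_eq_zero_iff,
      map_eq_zero_iff _ (rename_injective _ (Equiv.injective _))]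
    exact h0
  have hroot : Polynomial.aeval (x i) g = 0 := by
    rw [← hh]
    refine DFunLike.congr_fun (f := ((Polynomial.aeval (x i)).restrictScalars k).comp
      ((Polynomial.mapAlgHom (aeval y)).comp ((optionEquivLeft k {j // j ≠ i}).toAlgHom.comp
        (rename (Equiv.optionSubtypeNe i).symm)))) (algHom_ext fun j => ?_) h
    by_cases hj : j = i
    · simp [hj]
    · simp [hj, y]
  have hint : IsIntegral F (x i) := IsAlgebraic.isIntegral ⟨g, hg0, hroot⟩
  have htop : IntermediateField.adjoin F {x i} = ⊤ := by
    rw [← IntermediateField.restrictScalars_eq_top_iff (K := k),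
      IntermediateField.restrictScalars_adjoin, eq_top_iff, ← hadj]
    refine IntermediateField.adjoin.mono _ _ _ ?_
    rintro _ ⟨j, rfl⟩
    by_cases hj : j = i
    · exact Or.inr (congrArg x hj)
    · exact Or.inl (y ⟨j, hj⟩).2
  calc Module.finrank F K = Module.finrank F (IntermediateField.adjoin F {x i}) := by
        rw [htop, IntermediateField.finrank_top']
    _ = (minpoly F (x i)).natDegree := IntermediateField.adjoin.finrank hint
    _ ≤ g.natDegree := Polynomial.natDegree_le_of_dvd (minpoly.dvd F _ hroot) hg0
    _ ≤ h'.natDegree := Polynomial.natDegree_map_le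
    _ = degreeOf i h := (degreeOf_eq_natDegree i h).symm

theorem le_degreeOf_of_adjoin_eq_top {k K : Type*} [Field k] [Field K] [Algebra k K]
    {x : Fin 2 → K} {D : ℕ} (hx : ∀ i, Transcendental k (x i))
    (hD : ∀ i, D ≤ Module.finrank (IntermediateField.adjoin k {x i}) K)
    (hadj : IntermediateField.adjoin k (Set.range x) = ⊤) {h : MvPolynomial (Fin 2) k}
    (h0 : h ≠ 0) (hh : aeval x h = 0) (i : Fin 2) : D ≤ degreeOf i h := by
  have hcompl : ({i}ᶜ : Set (Fin 2)) = {i.rev} := by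
    ext j
    simp only [Set.mem_compl_iff, Set.mem_singleton_iff, Fin.ext_iff, Fin.val_rev]
    omega
  let : Unique {j // j ≠ i} :=
    { default := ⟨i.rev, hcompl.symm.subset rfl⟩
      uniq := fun j => Subtype.ext (hcompl.subset j.2) }
  have hind : AlgebraicIndependent k fun j : {j // j ≠ i} => x j :=
    algebraicIndependent_unique_type_iff.2 (hx _)
  have hle := finrank_adjoin_image_compl_le_degreeOf hind hadj h0 hh
  rw [hcompl, Set.image_singleton] at hle
  exact (hD _).trans hle

theorem totalDegree_pderiv_lt {σ R : Type*} [CommSemiring R] {f : MvPolynomial σ R}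
    {i : σ} (h : pderiv i f ≠ 0) : (pderiv i f).totalDegree < f.totalDegree := by
  have key : ∀ m ∈ (pderiv i f).support, (m.sum fun _ e => e) < f.totalDegree := by
    intro m hm
    rw [mem_support_iff, coeff_pderiv] at hm
    have hle := le_totalDegree (mem_support_iff.2 (left_ne_zero_of_mul hm))
    rw [Finsupp.sum_add_index' (fun _ => rfl) (fun _ _ _ => rfl), Finsupp.sum_single_index rfl]
      at hle
    omega
  obtain ⟨m, hm⟩ := support_nonempty.2 h
  exact (Finset.sup_lt_iff ((Nat.zero_le _).trans_lt (key m hm))).2 key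

theorem eq_C_of_pderiv_eq_zero {σ R : Type*} [CommSemiring R] [NoZeroDivisors R] [CharZero R]
    {f : MvPolynomial σ R} (hf : ∀ i, pderiv i f = 0) : f = C (coeff 0 f) := by
  classical
  ext m
  rw [coeff_C]
  split_ifs with h0
  · rw [← h0]
  · obtain ⟨i, hi⟩ := Finsupp.ne_iff.1 (Ne.symm h0)
    have hcoeff := coeff_pderiv (i := i) f (m - Finsupp.single i 1)
    rw [hf i, coeff_zero, tsub_add_cancel_of_le
      (Finsupp.single_le_iff.2 (Nat.one_le_iff_ne_zero.2 hi))] at hcoeff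
    exact (mul_eq_zero.1 hcoeff.symm).resolve_right (Nat.cast_add_one_ne_zero _)

theorem exists_not_dvd_pderiv {σ k : Type*} [Field k] [CharZero k]
    {f : MvPolynomial σ k} (hf : Irreducible f) : ∃ i, ¬ f ∣ pderiv i f := by
  by_contra! hdvd
  have hzero (i : σ) : pderiv i f = 0 := by
    by_contra h
    obtain ⟨q, hq⟩ := hdvd i
    have hlt := totalDegree_pderiv_lt h
    rw [hq, totalDegree_mul_of_isDomain hf.ne_zero (right_ne_zero_of_mul (hq ▸ h))] at hlt
    omega
  have hC := eq_C_of_pderiv_eq_zero hzero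
  have h0 : coeff 0 f ≠ 0 := fun h => hf.ne_zero (by rw [hC, h, map_zero])
  exact hf.not_isUnit (hC ▸ (isUnit_iff_ne_zero.2 h0).map C)

theorem derivation_aeval {R A M σ : Type*} [Fintype σ] [CommSemiring R] [CommSemiring A]
    [AddCommMonoid M] [Algebra R A] [Module A M] [Module R M]
    (D : Derivation R A M) (v : σ → A) (f : MvPolynomial σ R) :
    D (aeval v f) = ∑ i, aeval v (pderiv i f) • D (v i) := by
  classical
  induction f using MvPolynomial.induction_on with
  | C a => simp
  | add p q hp hq => simp only [map_add, hp, hq, add_smul, Finset.sum_add_distrib]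
  | mul_X p j hp =>
    simp only [map_mul, aeval_X, Derivation.leibniz, hp, Finset.smul_sum, pderiv_X, map_add,
      smul_eq_mul, add_smul, Finset.sum_add_distrib, mul_smul]
    simp [Pi.single_apply]

theorem exists_eq_map_add_I_mul_map {σ : Type*} (g : MvPolynomial σ ℂ) :
    ∃ u w : MvPolynomial σ ℝ,
      g = map (algebraMap ℝ ℂ) u + C Complex.I * map (algebraMap ℝ ℂ) w := by
  induction g using MvPolynomial.induction_on with
  | C z =>
    refine ⟨C z.re, C z.im, ?_⟩
    rw [map_C, map_C, ← map_mul, ← map_add]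
    congr 1
    rw [mul_comm]
    exact (Complex.re_add_im z).symm
  | add p q hp hq =>
    obtain ⟨u, w, rfl⟩ := hp
    obtain ⟨u', w', rfl⟩ := hq
    exact ⟨u + u', w + w', by simp only [map_add]; ring⟩
  | mul_X p i hp =>
    obtain ⟨u, w, rfl⟩ := hp
    exact ⟨u * X i, w * X i, by simp only [map_mul, map_X]; ring⟩

theorem coeff_mul_T {R : Type*} [Semiring R] (q : R[T;T⁻¹]) (n j : ℤ) :
    (q * T n).coeff j = q.coeff (j - n) := by
  simpa using AddMonoidAlgebra.coeff_mul_single_add q 1 n (j - n)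

/-- The space of Laurent polynomials whose exponents lie between `-M` and `M`. -/
noncomputable def laurentDegreeLE (R : Type*) [Semiring R] (M : ℕ) : Submodule R R[T;T⁻¹] :=
  AddMonoidAlgebra.supported R R (Set.Icc (-(M : ℤ)) M)

section laurentDegreeLE

variable {R : Type*} [Semiring R] {M N : ℕ}

theorem mem_laurentDegreeLE {q : R[T;T⁻¹]} :
    q ∈ laurentDegreeLE R M ↔ ∀ j : ℤ, (M : ℤ) < |j| → q.coeff j = 0 := by
  simp only [laurentDegreeLE, AddMonoidAlgebra.mem_supported', Set.mem_Icc, ← abs_le, not_le]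

theorem laurentDegreeLE_eq_span (R : Type*) [Semiring R] (M : ℕ) :
    laurentDegreeLE R M = Submodule.span R (T '' Set.Icc (-(M : ℤ)) M) :=
  AddMonoidAlgebra.supported_eq_span_single R _

theorem T_mem_laurentDegreeLE {j : ℤ} (hj : |j| ≤ M) : T j ∈ laurentDegreeLE R M := by
  rw [laurentDegreeLE_eq_span]
  exact Submodule.subset_span ⟨j, abs_le.1 hj, rfl⟩

theorem laurentDegreeLE_mono (h : M ≤ N) : laurentDegreeLE R M ≤ laurentDegreeLE R N :=
  AddMonoidAlgebra.supported_mono (Set.Icc_subset_Icc (by omega) (by omega))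

end laurentDegreeLE

section CommSemiring

variable {R : Type*} [CommSemiring R] {M N : ℕ}

theorem mul_mem_laurentDegreeLE {p q : R[T;T⁻¹]} (hp : p ∈ laurentDegreeLE R M)
    (hq : q ∈ laurentDegreeLE R N) : p * q ∈ laurentDegreeLE R (M + N) := by
  have hle : laurentDegreeLE R M * laurentDegreeLE R N ≤ laurentDegreeLE R (M + N) := by
    rw [laurentDegreeLE_eq_span, laurentDegreeLE_eq_span, Submodule.span_mul_span,
      Submodule.span_le]
    rintro _ ⟨_, ⟨i, hi, rfl⟩, _, ⟨j, hj, rfl⟩, rfl⟩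
    rw [Set.mem_Icc] at hi hj
    change T i * T j ∈ laurentDegreeLE R (M + N)
    rw [← T_add]
    exact T_mem_laurentDegreeLE (abs_le.2 ⟨by omega, by omega⟩)
  exact hle (Submodule.mul_mem_mul hp hq)

theorem pow_mem_laurentDegreeLE {q : R[T;T⁻¹]} (hq : q ∈ laurentDegreeLE R M) (n : ℕ) :
    q ^ n ∈ laurentDegreeLE R (n * M) := by
  induction n with
  | zero => simpa using T_mem_laurentDegreeLE (R := R) (M := 0) (j := 0) (by simp)
  | succ n ih => rw [pow_succ, add_mul, one_mul]; exact mul_mem_laurentDegreeLE ih hq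

theorem aeval_mem_laurentDegreeLE {σ : Type*} [Finite σ] {v : σ → R[T;T⁻¹]}
    (hv : ∀ i, v i ∈ laurentDegreeLE R M) (f : MvPolynomial σ R) :
    aeval v f ∈ laurentDegreeLE R (f.totalDegree * M) := by
  classical
  cases nonempty_fintype σ
  have hprod (e : σ →₀ ℕ) (s : Finset σ) :
      ∏ i ∈ s, v i ^ e i ∈ laurentDegreeLE R ((∑ i ∈ s, e i) * M) := by
    induction s using Finset.induction_on with
    | empty => simpa using T_mem_laurentDegreeLE (R := R) (M := 0) (j := 0) (by simp)
    | insert i s hi ih =>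
      rw [Finset.prod_insert hi, Finset.sum_insert hi, add_mul]
      exact mul_mem_laurentDegreeLE (pow_mem_laurentDegreeLE (hv i) _) ih
  rw [aeval_def, eval₂_eq']
  refine Submodule.sum_mem _ fun e he => ?_
  rw [← Algebra.smul_def]
  refine Submodule.smul_mem _ _ (laurentDegreeLE_mono (Nat.mul_le_mul_right M ?_) (hprod e _))
  rw [← Finsupp.sum_fintype e (fun _ n => n) fun _ => rfl]
  exact le_totalDegree he

end CommSemiring

instance (k : Type*) [Field k] (M : ℕ) : FiniteDimensional k (laurentDegreeLE k M) :=
  Module.Finite.equiv (AddMonoidAlgebra.supportedEquivFinsupp _).symm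

theorem finrank_laurentDegreeLE (k : Type*) [Field k] (M : ℕ) :
    Module.finrank k (laurentDegreeLE k M) = 2 * M + 1 := by
  rw [laurentDegreeLE, (AddMonoidAlgebra.supportedEquivFinsupp _).finrank_eq,
    Module.finrank_finsupp_self, Fintype.card_ofFinset, Int.card_Icc]
  omega

theorem finrank_map_aeval_restrictTotalDegree_le {k σ : Type*} [Field k] [Finite σ]
    {v : σ → k[T;T⁻¹]} {M : ℕ} (hv : ∀ i, v i ∈ laurentDegreeLE k M) (d : ℕ) :
    Module.finrank k ((restrictTotalDegree σ k d).map (aeval v).toLinearMap)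
      ≤ d * (2 * M) + 1 := by
  have hle : (restrictTotalDegree σ k d).map (aeval v).toLinearMap ≤ laurentDegreeLE k (d * M) := by
    rintro _ ⟨f, hf, rfl⟩
    exact laurentDegreeLE_mono (Nat.mul_le_mul_right M ((mem_restrictTotalDegree _ _ _).1 hf))
      (aeval_mem_laurentDegreeLE hv f)
  calc _ ≤ _ := Submodule.finrank_mono hle
    _ = 2 * (d * M) + 1 := finrank_laurentDegreeLE k _
    _ = d * (2 * M) + 1 := by ring

/-- `q` has exponents between `-M` and `M`, and both extreme coefficients are nonzero. -/
structure HasTwoSidedDegree {R : Type*} [Semiring R] (q : R[T;T⁻¹]) (M : ℕ) : Prop where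
  mem_laurentDegreeLE : q ∈ laurentDegreeLE R M
  coeff_top_ne_zero : q.coeff M ≠ 0
  coeff_bot_ne_zero : q.coeff (-M) ≠ 0

/-- Evaluation of Laurent polynomials at a unit. -/
noncomputable def laurentAeval {k A : Type*} [CommSemiring k] [CommSemiring A] [Algebra k A]
    (u : Aˣ) : k[T;T⁻¹] →ₐ[k] A :=
  { eval₂ (algebraMap k A) u with commutes' := eval₂_C _ _ }

section laurentAeval

variable {k A : Type*} [CommRing k] [CommRing A] [Algebra k A] (u : Aˣ)

theorem laurentAeval_T (j : ℤ) : laurentAeval u (T j : k[T;T⁻¹]) = ↑(u ^ j) :=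
  eval₂_T _ _ _

theorem laurentAeval_toLaurent (g : Polynomial k) :
    laurentAeval u (Polynomial.toLaurent g) = Polynomial.aeval (u : A) g :=
  eval₂_toLaurent _ _ _

theorem laurentAeval_injective (hu : Transcendental k (u : A)) :
    Function.Injective (laurentAeval u : k[T;T⁻¹] →ₐ[k] A) := by
  rw [injective_iff_map_eq_zero]
  intro q hq
  obtain ⟨n, g, hg⟩ := exists_T_pow q
  have hroot : Polynomial.aeval (u : A) g = 0 := by
    rw [← laurentAeval_toLaurent, hg, map_mul, hq, zero_mul]
  rw [transcendental_iff.1 hu g hroot, map_zero] at hg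
  exact (isUnit_T (n : ℤ)).mul_left_eq_zero.1 hg.symm

end laurentAeval

/-- The value at `exp (θ i)`: it turns Laurent polynomials into trigonometric polynomials. -/
noncomputable def evalCircle (θ : ℝ) : ℂ[T;T⁻¹] →ₐ[ℂ] ℂ :=
  laurentAeval (Units.mk0 (Complex.exp (θ * Complex.I)) (Complex.exp_ne_zero _))

theorem evalCircle_T (θ : ℝ) (j : ℤ) :
    evalCircle θ (T j) = Complex.exp (j * (θ * Complex.I)) := by
  rw [evalCircle, laurentAeval_T, Units.val_zpow_eq_zpow_val, Units.val_mk0, ← Complex.exp_int_mul]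

theorem eq_zero_of_evalCircle_eq_zero {q : ℂ[T;T⁻¹]}
    (hq : ∀ θ ∈ Set.Icc (-Real.pi) Real.pi, evalCircle θ q = 0) : q = 0 := by
  obtain ⟨n, g, hg⟩ := exists_T_pow q
  have hroot : ∀ θ ∈ Set.Ioc (-Real.pi) Real.pi, g.IsRoot (Complex.exp (θ * Complex.I)) := by
    intro θ hθ
    have h := congrArg (evalCircle θ) hg
    rwa [map_mul, hq θ (Set.Ioc_subset_Icc_self hθ), zero_mul, evalCircle,
      laurentAeval_toLaurent, Polynomial.coe_aeval_eq_eval] at h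
  have hinj : Set.InjOn (fun θ : ℝ => Complex.exp (θ * Complex.I)) (Set.Ioc (-Real.pi) Real.pi) :=
    fun s hs t ht hst => Circle.exp_injOn_Ioc (by linarith) hs ht
      (Circle.ext (by simpa only [Circle.coe_exp] using hst))
  have hinf := (Set.Ioc_infinite (neg_lt_self Real.pi_pos)).image hinj
  have hg0 : g = 0 :=
    Polynomial.eq_zero_of_infinite_isRoot g (hinf.mono (Set.image_subset_iff.2 hroot))
  rw [hg0, map_zero] at hg
  exact (isUnit_T (n : ℤ)).mul_left_eq_zero.1 hg.symm

/-- The embedding of the Laurent polynomials into the field of rational functions. -/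
noncomputable def toRatFunc (k : Type*) [Field k] : k[T;T⁻¹] →ₐ[k] RatFunc k :=
  laurentAeval (Units.mk0 RatFunc.X RatFunc.X_ne_zero)

section toRatFunc

variable {k : Type*} [Field k]

theorem toRatFunc_T (j : ℤ) : toRatFunc k (T j) = RatFunc.X ^ j := by
  rw [toRatFunc, laurentAeval_T, Units.val_zpow_eq_zpow_val, Units.val_mk0]

theorem toRatFunc_toLaurent (g : Polynomial k) :
    toRatFunc k (Polynomial.toLaurent g) = algebraMap (Polynomial k) (RatFunc k) g := by
  rw [toRatFunc, laurentAeval_toLaurent, Units.val_mk0, RatFunc.aeval_X_left_eq_algebraMap]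

theorem toRatFunc_injective : Function.Injective (toRatFunc k) :=
  laurentAeval_injective _ RatFunc.transcendental_X

end toRatFunc

theorem coeff_toLaurent_natCast {R : Type*} [Semiring R] (g : Polynomial R) (i : ℕ) :
    (Polynomial.toLaurent g).coeff i = g.coeff i := by
  rw [LaurentPolynomial.coeff_toLaurent]
  exact Finsupp.mapDomain_apply Nat.castEmbedding.injective _ i

theorem exists_toLaurent_eq_mul_T {R : Type*} [CommSemiring R] {q : R[T;T⁻¹]} {M : ℕ}
    (hq : q ∈ laurentDegreeLE R M) : ∃ g : Polynomial R, Polynomial.toLaurent g = q * T M := by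
  rw [laurentDegreeLE_eq_span] at hq
  induction hq using Submodule.span_induction with
  | mem q hq =>
    obtain ⟨j, hj, rfl⟩ := hq
    refine ⟨Polynomial.X ^ (j + M).toNat, ?_⟩
    rw [Polynomial.toLaurent_X_pow, ← T_add, Int.toNat_of_nonneg (by linarith [hj.1])]
  | zero => exact ⟨0, by simp⟩
  | add p q _ _ hp hq =>
    obtain ⟨g, hg⟩ := hp
    obtain ⟨h, hh⟩ := hq
    exact ⟨g + h, by rw [map_add, hg, hh, add_mul]⟩
  | smul c q _ hq =>
    obtain ⟨g, hg⟩ := hq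
    exact ⟨c • g, by rw [← Polynomial.toLaurentAlg_apply, map_smul, Polynomial.toLaurentAlg_apply,
      hg, smul_mul_assoc]⟩

theorem two_mul_le_finrank_adjoin_toRatFunc {k : Type*} [Field k] {q : k[T;T⁻¹]} {M : ℕ}
    (hq : HasTwoSidedDegree q M) :
    2 * M ≤ Module.finrank (IntermediateField.adjoin k {toRatFunc k q}) (RatFunc k) := by
  obtain ⟨g, hg⟩ := exists_toLaurent_eq_mul_T hq.mem_laurentDegreeLE
  have hcoeff (i : ℕ) : g.coeff i = q.coeff (i - M) := by
    rw [← coeff_toLaurent_natCast, hg, coeff_mul_T]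
  have hbot : g.coeff 0 ≠ 0 := by
    rw [hcoeff]
    simpa using hq.coeff_bot_ne_zero
  have hdeg : 2 * M ≤ g.natDegree := by
    refine Polynomial.le_natDegree_of_ne_zero ?_
    rw [hcoeff, show ((2 * M : ℕ) : ℤ) - M = M by push_cast; ring]
    exact hq.coeff_top_ne_zero
  have hcop : IsCoprime g (Polynomial.X ^ M) := IsCoprime.pow_right <| IsCoprime.symm <|
    Polynomial.irreducible_X.coprime_iff_not_dvd.2 (Polynomial.X_dvd_iff.not.2 hbot)
  set x := toRatFunc k q
  have hfrac : x = algebraMap (Polynomial k) (RatFunc k) g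
      / algebraMap (Polynomial k) (RatFunc k) (Polynomial.X ^ M) := by
    have h := congrArg (toRatFunc k) hg
    rw [toRatFunc_toLaurent, map_mul, toRatFunc_T, zpow_natCast] at h
    rw [map_pow, RatFunc.algebraMap_X, h, mul_div_cancel_right₀ _ (pow_ne_zero _ RatFunc.X_ne_zero)]
  have hmul : x.num * Polynomial.X ^ M = g * x.denom :=
    (RatFunc.num_mul_eq_mul_denom_iff (pow_ne_zero _ Polynomial.X_ne_zero)).2 hfrac
  have hnum : x.num ≠ 0 := by
    have hg0 : g ≠ 0 := fun h => hbot (by rw [h, Polynomial.coeff_zero])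
    exact left_ne_zero_of_mul (hmul ▸ mul_ne_zero hg0 x.denom_ne_zero)
  have hdvd : g ∣ x.num := hcop.dvd_of_dvd_mul_right (Dvd.intro _ hmul.symm)
  rw [RatFunc.finrank_eq_max_natDegree]
  exact hdeg.trans ((Polynomial.natDegree_le_of_dvd hdvd hnum).trans (le_max_left _ _))

theorem transcendental_toRatFunc {k : Type*} [Field k] {q : k[T;T⁻¹]} {M : ℕ} (hM : M ≠ 0)
    (hq : HasTwoSidedDegree q M) : Transcendental k (toRatFunc k q) := by
  refine RatFunc.transcendental_of_ne_C _ ?_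
  rintro ⟨c, hc⟩
  have hle := two_mul_le_finrank_adjoin_toRatFunc hq
  rw [hc, RatFunc.finrank_eq_max_natDegree, RatFunc.num_C, RatFunc.denom_C,
    Polynomial.natDegree_C, Polynomial.natDegree_one] at hle
  omega

theorem exists_eq_add_T_mul_of_sq_mem {k : Type*} [Field k] {S : IntermediateField k (RatFunc k)}
    (hS : RatFunc.X ^ 2 ∈ S) (q : k[T;T⁻¹]) :
    ∃ e o : k[T;T⁻¹], toRatFunc k e ∈ S ∧ toRatFunc k o ∈ S ∧ q = e + T 1 * o ∧
      ∀ j, o.coeff (2 * j) = q.coeff (2 * j + 1) := by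
  have heven (c : k) (j : ℤ) : toRatFunc k (c • T (2 * j)) ∈ S := by
    rw [map_smul, toRatFunc_T, zpow_mul]
    exact S.smul_mem (zpow_mem hS j)
  induction q using LaurentPolynomial.induction_on' with
  | add p q hp hq =>
    obtain ⟨e, o, he, ho, h, hc⟩ := hp
    obtain ⟨e', o', he', ho', h', hc'⟩ := hq
    exact ⟨e + e', o + o', by simpa using add_mem he he', by simpa using add_mem ho ho',
      by rw [h, h']; ring, fun j => by simp [hc, hc']⟩
  | C_mul_T n c =>
    rw [← LaurentPolynomial.smul_eq_C_mul]
    obtain ⟨j, rfl | rfl⟩ := Int.even_or_odd' n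
    · refine ⟨c • T (2 * j), 0, heven c j, by simp, by simp, fun i => ?_⟩
      rw [AddMonoidAlgebra.coeff_smul, Finsupp.smul_apply, T_apply,
        if_neg (by omega), smul_zero, AddMonoidAlgebra.coeff_zero, Finsupp.zero_apply]
    · refine ⟨0, c • T (2 * j), by simp, heven c j, ?_, fun i => ?_⟩
      · rw [zero_add, mul_smul_comm, ← T_add, add_comm]
      · simp only [AddMonoidAlgebra.coeff_smul, Finsupp.smul_apply, T_apply,
          add_left_inj]

theorem X_mem_of_X_sq_mem {k : Type*} [Field k] {S : IntermediateField k (RatFunc k)}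
    (hS : RatFunc.X ^ 2 ∈ S) {q : k[T;T⁻¹]} (hq : toRatFunc k q ∈ S) {j : ℤ} (hj : Odd j)
    (hcoeff : q.coeff j ≠ 0) : RatFunc.X ∈ S := by
  obtain ⟨e, o, he, ho, rfl, hc⟩ := exists_eq_add_T_mul_of_sq_mem hS q
  obtain ⟨i, rfl⟩ := hj
  have ho0 : toRatFunc k o ≠ 0 := by
    rw [map_ne_zero_iff _ toRatFunc_injective]
    rintro rfl
    exact hcoeff ((hc i).symm.trans rfl)
  have hX : RatFunc.X = (toRatFunc k (e + T 1 * o) - toRatFunc k e) / toRatFunc k o := by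
    rw [map_add, map_mul, toRatFunc_T, zpow_one, add_sub_cancel_left, mul_div_cancel_right₀ _ ho0]
  rw [hX]
  exact div_mem (sub_mem hq he) ho

/-- The derivation which `evalCircle` turns into differentiation with respect to the angle. -/
noncomputable def angleDeriv : Derivation ℂ ℂ[T;T⁻¹] ℂ[T;T⁻¹] :=
  let D := (AddMonoidAlgebra.basis ℤ ℂ).constr ℂ fun j => (j * Complex.I) • (T j : ℂ[T;T⁻¹])
  have hD (j : ℤ) : D (T j) = (j * Complex.I) • T j :=
    (AddMonoidAlgebra.basis ℤ ℂ).constr_basis ℂ _ j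
  Derivation.mk' D fun p q => by
    induction p using LaurentPolynomial.induction_on' with
    | add p p' hp hp' => simp only [add_mul, map_add, hp, hp', add_smul, smul_add]; abel
    | C_mul_T m a =>
      induction q using LaurentPolynomial.induction_on' with
      | add q q' hq hq' => simp only [mul_add, map_add, hq, hq', add_smul, smul_add]; abel
      | C_mul_T n b =>
        simp only [← LaurentPolynomial.smul_eq_C_mul, map_smul, smul_mul_assoc, mul_smul_comm,
          ← T_add, hD, smul_eq_mul, add_comm n m]
        push_cast
        module

theorem angleDeriv_T (j : ℤ) : angleDeriv (T j) = (j * Complex.I) • T j :=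
  (AddMonoidAlgebra.basis ℤ ℂ).constr_basis ℂ _ j

theorem coeff_angleDeriv (q : ℂ[T;T⁻¹]) (j : ℤ) :
    (angleDeriv q).coeff j = j * Complex.I * q.coeff j := by
  induction q using LaurentPolynomial.induction_on' with
  | add p q hp hq => simp [hp, hq, mul_add]
  | C_mul_T n c =>
    rw [← LaurentPolynomial.smul_eq_C_mul, Derivation.map_smul, angleDeriv_T]
    by_cases h : n = j <;> simp [T_apply, h, mul_comm]

theorem hasDerivAt_evalCircle (q : ℂ[T;T⁻¹]) (θ : ℝ) :
    HasDerivAt (fun t : ℝ => evalCircle t q) (evalCircle θ (angleDeriv q)) θ := by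
  induction q using LaurentPolynomial.induction_on' with
  | add p q hp hq => simpa only [map_add] using! hp.add hq
  | C_mul_T n c =>
    have hexp : HasDerivAt (fun t : ℝ => (n : ℂ) * (t * Complex.I)) (n * (1 * Complex.I)) θ :=
      ((Complex.ofRealCLM.hasDerivAt (x := θ)).mul_const Complex.I).const_mul _
    simp only [← LaurentPolynomial.smul_eq_C_mul, Derivation.map_smul, map_smul, angleDeriv_T,
      evalCircle_T, smul_eq_mul]
    convert! hexp.cexp.const_mul c using 1
    ring

theorem ofReal_deriv_eq_evalCircle {p : ℝ → ℝ} {P : ℂ[T;T⁻¹]}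
    (hP : ∀ θ, (p θ : ℂ) = evalCircle θ P) (θ : ℝ) :
    ((deriv p θ : ℝ) : ℂ) = evalCircle θ (angleDeriv P) := by
  have hcomplex : HasDerivAt (fun t => (p t : ℂ)) (evalCircle θ (angleDeriv P)) θ := by
    simpa only [hP] using hasDerivAt_evalCircle P θ
  have hreal : HasDerivAt p (evalCircle θ (angleDeriv P)).re θ :=
    Complex.reCLM.hasFDerivAt.comp_hasDerivAt θ hcomplex
  exact hreal.differentiableAt.hasDerivAt.ofReal_comp.unique hcomplex

/-- The Laurent polynomial of the trigonometric polynomial `cos (j θ)`. -/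
noncomputable def laurentCos (j : ℤ) : ℂ[T;T⁻¹] := (1 / 2 : ℂ) • (T j + T (-j))

/-- The Laurent polynomial of the trigonometric polynomial `sin (j θ)`. -/
noncomputable def laurentSin (j : ℤ) : ℂ[T;T⁻¹] := (-Complex.I / 2) • (T j - T (-j))

theorem evalCircle_laurentCos (θ : ℝ) (j : ℤ) :
    evalCircle θ (laurentCos j) = (Real.cos (j * θ) : ℂ) := by
  simp only [laurentCos, map_smul, map_add, evalCircle_T, Complex.ofReal_cos, Complex.cos,
    smul_eq_mul]
  push_cast
  ring_nf

theorem evalCircle_laurentSin (θ : ℝ) (j : ℤ) :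
    evalCircle θ (laurentSin j) = (Real.sin (j * θ) : ℂ) := by
  simp only [laurentSin, map_smul, map_sub, evalCircle_T, Complex.ofReal_sin, Complex.sin,
    smul_eq_mul]
  push_cast
  ring_nf

theorem angleDeriv_laurentCos (j : ℤ) : angleDeriv (laurentCos j) = -(j : ℂ) • laurentSin j := by
  simp only [laurentCos, laurentSin, Derivation.map_smul, map_add, angleDeriv_T]
  push_cast
  module

theorem angleDeriv_laurentSin (j : ℤ) : angleDeriv (laurentSin j) = (j : ℂ) • laurentCos j := by
  simp only [laurentCos, laurentSin, Derivation.map_smul, map_sub, angleDeriv_T]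
  push_cast
  match_scalars <;> linear_combination (-(j : ℂ) / 2) * Complex.I_mul_I

section LaurentCurve

variable {σ : Type*} {γ : ℝ → σ → ℝ} {v : σ → ℂ[T;T⁻¹]}

theorem ofReal_aeval_eq_evalCircle (hγ : ∀ θ i, (γ θ i : ℂ) = evalCircle θ (v i)) (θ : ℝ)
    (g : MvPolynomial σ ℝ) : ((aeval (γ θ) g : ℝ) : ℂ) = evalCircle θ (aeval v g) := by
  refine DFunLike.congr_fun (f := Complex.ofRealAm.comp (aeval (γ θ)))
    (g := ((evalCircle θ).restrictScalars ℝ).comp (aeval v)) (algHom_ext fun i => ?_) g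
  simp [hγ]

theorem vanishingIdeal_image_eq_ker (hγ : ∀ θ i, (γ θ i : ℂ) = evalCircle θ (v i)) :
    vanishingIdeal ℝ (γ '' Set.Icc (-Real.pi) Real.pi)
      = RingHom.ker (aeval v : MvPolynomial σ ℝ →ₐ[ℝ] ℂ[T;T⁻¹]) := by
  ext g
  rw [mem_vanishingIdeal_iff, Set.forall_mem_image, RingHom.mem_ker]
  constructor
  · intro h
    refine eq_zero_of_evalCircle_eq_zero fun θ hθ => ?_
    rw [← ofReal_aeval_eq_evalCircle hγ, h hθ, Complex.ofReal_zero]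
  · intro h θ _
    rw [← Complex.ofReal_eq_zero, ofReal_aeval_eq_evalCircle hγ, h, map_zero]

theorem map_dvd_of_aeval_eq_zero (hγ : ∀ θ i, (γ θ i : ℂ) = evalCircle θ (v i))
    {f : MvPolynomial σ ℝ} (hf : ∀ g : MvPolynomial σ ℝ, aeval v g = 0 → f ∣ g)
    {g : MvPolynomial σ ℂ} (hg : aeval v g = 0) : map (algebraMap ℝ ℂ) f ∣ g := by
  obtain ⟨u, w, rfl⟩ := exists_eq_map_add_I_mul_map g
  have hval (θ : ℝ) : ((aeval (γ θ) u : ℝ) : ℂ) + Complex.I * ((aeval (γ θ) w : ℝ) : ℂ) = 0 := by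
    have h := congrArg (evalCircle θ) hg
    rw [map_add, map_mul, aeval_map_algebraMap, aeval_map_algebraMap, algHom_C, map_add, map_mul,
      AlgHom.commutes, map_zero] at h
    rw [ofReal_aeval_eq_evalCircle hγ, ofReal_aeval_eq_evalCircle hγ]
    exact h
  have hu : aeval v u = 0 := eq_zero_of_evalCircle_eq_zero fun θ _ => by
    rw [← ofReal_aeval_eq_evalCircle hγ, Complex.ofReal_eq_zero]
    simpa using congrArg Complex.re (hval θ)
  have hw : aeval v w = 0 := eq_zero_of_evalCircle_eq_zero fun θ _ => by
    rw [← ofReal_aeval_eq_evalCircle hγ, Complex.ofReal_eq_zero]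
    simpa using congrArg Complex.im (hval θ)
  exact dvd_add (map_dvd _ (hf u hu)) ((map_dvd _ (hf w hw)).mul_left _)

theorem not_isMaximal_ker_aeval (hγ : ∀ θ i, (γ θ i : ℂ) = evalCircle θ (v i)) {i : σ} {j : ℤ}
    (hj : j ≠ 0) (hv : (v i).coeff j ≠ 0) :
    ¬ (RingHom.ker (aeval v : MvPolynomial σ ℝ →ₐ[ℝ] ℂ[T;T⁻¹])).IsMaximal := by
  intro hmax
  have hle : RingHom.ker (aeval v : MvPolynomial σ ℝ →ₐ[ℝ] ℂ[T;T⁻¹])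
      ≤ RingHom.ker (aeval (γ 0) : MvPolynomial σ ℝ →ₐ[ℝ] ℝ) := fun g hg => by
    rw [RingHom.mem_ker] at hg ⊢
    rw [← Complex.ofReal_eq_zero, ofReal_aeval_eq_evalCircle hγ, hg, map_zero]
  have hmem : X i - C (γ 0 i) ∈ RingHom.ker (aeval v : MvPolynomial σ ℝ →ₐ[ℝ] ℂ[T;T⁻¹]) := by
    rw [hmax.eq_of_le (RingHom.ker_ne_top _) hle]
    simp
  have hconst : v i = algebraMap ℝ ℂ[T;T⁻¹] (γ 0 i) := by
    simpa [sub_eq_zero] using hmem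
  rw [hconst, LaurentPolynomial.algebraMap_apply, ← LaurentPolynomial.single_eq_C,
    AddMonoidAlgebra.coeff_single, Finsupp.single_eq_of_ne hj] at hv
  exact hv rfl

end LaurentCurve

section LaurentPlaneCurve

variable {γ : ℝ → Fin 2 → ℝ} {v : Fin 2 → ℂ[T;T⁻¹]} {M : ℕ}

theorem exists_isDefiningPolynomial_image (hγ : ∀ θ i, (γ θ i : ℂ) = evalCircle θ (v i))
    (hM : M ≠ 0) (hv : ∀ i, HasTwoSidedDegree (v i) M) :
    ∃ f, IsDefiningPolynomial (γ '' Set.Icc (-Real.pi) Real.pi) f := by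
  have hdim : ringKrullDim (MvPolynomial (Fin 2) ℝ) ≤ 2 := by
    rw [ringKrullDim_of_isNoetherianRing, ringKrullDim_eq_zero_of_field, zero_add]
    simp
  have hbot : RingHom.ker (aeval v : MvPolynomial (Fin 2) ℝ →ₐ[ℝ] ℂ[T;T⁻¹]) ≠ ⊥ := by
    intro hker
    obtain ⟨g, hg0, hg⟩ := exists_ne_zero_of_finrank_map_le (aeval v).toLinearMap (2 * M)
      (finrank_map_aeval_restrictTotalDegree_le fun i => (hv i).mem_laurentDegreeLE)
    have hdvd : map (algebraMap ℝ ℂ) 0 ∣ g := map_dvd_of_aeval_eq_zero hγ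
      (fun u hu => zero_dvd_iff.2 (RingHom.ker_eq_bot_iff_eq_zero _ |>.1 hker u hu)) hg
    rw [map_zero] at hdvd
    exact hg0 (zero_dvd_iff.1 hdvd)
  have : (RingHom.ker (aeval v : MvPolynomial (Fin 2) ℝ →ₐ[ℝ] ℂ[T;T⁻¹])).IsPrime :=
    RingHom.ker_isPrime _
  obtain ⟨f, hf, hker⟩ := exists_prime_eq_span_singleton hdim
    (not_isMaximal_ker_aeval hγ (Nat.cast_ne_zero.2 hM) (hv 0).coeff_top_ne_zero) hbot
  exact ⟨f, hf.irreducible, (vanishingIdeal_image_eq_ker hγ).trans hker⟩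

theorem IsDefiningPolynomial.aeval_eq_zero_iff_dvd
    (hγ : ∀ θ i, (γ θ i : ℂ) = evalCircle θ (v i)) {f : MvPolynomial (Fin 2) ℝ}
    (hf : IsDefiningPolynomial (γ '' Set.Icc (-Real.pi) Real.pi) f) {g : MvPolynomial (Fin 2) ℝ} :
    aeval v g = 0 ↔ f ∣ g := by
  rw [← Ideal.mem_span_singleton, ← hf.vanishingIdeal_eq, vanishingIdeal_image_eq_ker hγ,
    RingHom.mem_ker]

theorem IsDefiningPolynomial.totalDegree_le (hγ : ∀ θ i, (γ θ i : ℂ) = evalCircle θ (v i))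
    (hv : ∀ i, v i ∈ laurentDegreeLE ℂ M) {f : MvPolynomial (Fin 2) ℝ}
    (hf : IsDefiningPolynomial (γ '' Set.Icc (-Real.pi) Real.pi) f) : f.totalDegree ≤ 2 * M := by
  have hinj : Function.Injective (algebraMap ℝ ℂ) := Complex.ofReal_injective
  have hle := totalDegree_le_of_ker_dvd (aeval v).toLinearMap (2 * M)
    (finrank_map_aeval_restrictTotalDegree_le hv)
    ((map_ne_zero_iff _ (map_injective _ hinj)).2 hf.irreducible.ne_zero)
    fun g hg => map_dvd_of_aeval_eq_zero hγ (fun u => (hf.aeval_eq_zero_iff_dvd hγ).1) hg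
  rwa [totalDegree, support_map_of_injective _ hinj] at hle

theorem IsDefiningPolynomial.le_degreeOf (hγ : ∀ θ i, (γ θ i : ℂ) = evalCircle θ (v i))
    (hM : M ≠ 0) (hv : ∀ i, HasTwoSidedDegree (v i) M)
    (hadj : IntermediateField.adjoin ℂ (Set.range fun i => toRatFunc ℂ (v i)) = ⊤)
    {f : MvPolynomial (Fin 2) ℝ}
    (hf : IsDefiningPolynomial (γ '' Set.Icc (-Real.pi) Real.pi) f) (i : Fin 2) :
    2 * M ≤ degreeOf i f := by
  classical
  have hinj : Function.Injective (algebraMap ℝ ℂ) := Complex.ofReal_injective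
  have hroot : aeval (fun i => toRatFunc ℂ (v i)) (map (algebraMap ℝ ℂ) f) = 0 := by
    rw [← comp_aeval_apply, aeval_map_algebraMap, (hf.aeval_eq_zero_iff_dvd hγ).2 dvd_rfl, map_zero]
  have hle := le_degreeOf_of_adjoin_eq_top (fun i => transcendental_toRatFunc hM (hv i))
    (fun i => two_mul_le_finrank_adjoin_toRatFunc (hv i)) hadj
    ((map_ne_zero_iff _ (map_injective _ hinj)).2 hf.irreducible.ne_zero) hroot i
  rwa [degreeOf_def, degrees_map_of_injective _ hinj, ← degreeOf_def] at hle

end LaurentPlaneCurve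

/-- The Laurent polynomials of the coordinates of `supportParam p`, for a support function `p`
whose Laurent polynomial is `P`. -/
noncomputable def supportLaurent (P : ℂ[T;T⁻¹]) : Fin 2 → ℂ[T;T⁻¹] :=
  ![P * laurentCos 1 - angleDeriv P * laurentSin 1, P * laurentSin 1 + angleDeriv P * laurentCos 1]

theorem ofReal_supportParam {p : ℝ → ℝ} {P : ℂ[T;T⁻¹]} (hP : ∀ θ, (p θ : ℂ) = evalCircle θ P)
    (θ : ℝ) (i : Fin 2) : (supportParam p θ i : ℂ) = evalCircle θ (supportLaurent P i) := by
  fin_cases i <;>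
    simp [supportParam, supportLaurent, evalCircle_laurentCos, evalCircle_laurentSin, hP,
      ofReal_deriv_eq_evalCircle hP]

theorem coeff_supportLaurent_zero (P : ℂ[T;T⁻¹]) (j : ℤ) :
    (supportLaurent P 0).coeff j
      = (1 / 2) * ((2 - j) * P.coeff (j - 1) + (2 + j) * P.coeff (j + 1)) := by
  simp only [supportLaurent, laurentCos, laurentSin, Matrix.cons_val_zero, mul_smul_comm, mul_add,
    mul_sub, AddMonoidAlgebra.coeff_sub, AddMonoidAlgebra.coeff_smul, AddMonoidAlgebra.coeff_add,
    Finsupp.sub_apply, Finsupp.smul_apply, Finsupp.add_apply, coeff_mul_T, coeff_angleDeriv,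
    sub_neg_eq_add, smul_eq_mul]
  push_cast
  linear_combination
    ((j - 1) / 2 * P.coeff (j - 1) - (j + 1) / 2 * P.coeff (j + 1)) * Complex.I_mul_I

theorem coeff_supportLaurent_one (P : ℂ[T;T⁻¹]) (j : ℤ) :
    (supportLaurent P 1).coeff j
      = (-Complex.I / 2) * ((2 - j) * P.coeff (j - 1) - (2 + j) * P.coeff (j + 1)) := by
  simp only [supportLaurent, laurentCos, laurentSin, Matrix.cons_val_one, mul_smul_comm, mul_add,
    mul_sub, AddMonoidAlgebra.coeff_sub, AddMonoidAlgebra.coeff_smul, AddMonoidAlgebra.coeff_add,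
    Finsupp.sub_apply, Finsupp.smul_apply, Finsupp.add_apply, coeff_mul_T, coeff_angleDeriv,
    sub_neg_eq_add, smul_eq_mul, Matrix.cons_val_fin_one]
  push_cast
  ring

theorem hasTwoSidedDegree_supportLaurent {P : ℂ[T;T⁻¹]} {N : ℕ} (hN : N ≠ 1)
    (hP : HasTwoSidedDegree P N) (i : Fin 2) : HasTwoSidedDegree (supportLaurent P i) (N + 1) := by
  have hzero := mem_laurentDegreeLE.1 hP.mem_laurentDegreeLE
  have hN' : (1 - N : ℂ) ≠ 0 := sub_ne_zero.2 (by exact_mod_cast hN.symm)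
  have htop : P.coeff (N + 1 + 1) = 0 := hzero _ (by rw [lt_abs]; omega)
  have hbot : P.coeff (-(N + 1) - 1) = 0 := hzero _ (by rw [lt_abs]; omega)
  refine ⟨mem_laurentDegreeLE.2 fun j hj => ?_, ?_, ?_⟩
  · rw [lt_abs] at hj
    have hsub : P.coeff (j - 1) = 0 := hzero _ (by rw [lt_abs]; omega)
    have hadd : P.coeff (j + 1) = 0 := hzero _ (by rw [lt_abs]; omega)
    fin_cases i <;> simp [coeff_supportLaurent_zero, coeff_supportLaurent_one, hsub, hadd]
  · have hcoef : (2 - (N + 1) : ℂ) ≠ 0 := by convert hN' using 1; ring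
    push_cast
    fin_cases i <;>
      simp [coeff_supportLaurent_zero, coeff_supportLaurent_one, htop, hP.coeff_top_ne_zero,
        Complex.I_ne_zero, hcoef]
  · have hcoef : (2 + -(N + 1) : ℂ) ≠ 0 := by convert hN' using 1; ring
    push_cast
    fin_cases i <;>
      simp [coeff_supportLaurent_zero, coeff_supportLaurent_one, hbot, hP.coeff_bot_ne_zero,
        Complex.I_ne_zero, hcoef, (by ring : -(N + 1 : ℤ) + 1 = -N), -neg_add_rev]

theorem angleDeriv_supportLaurent_zero (P : ℂ[T;T⁻¹]) :
    angleDeriv (supportLaurent P 0) = -((P + angleDeriv (angleDeriv P)) * laurentSin 1) := by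
  change angleDeriv (P * laurentCos 1 - angleDeriv P * laurentSin 1) = _
  simp only [map_sub, Derivation.leibniz, angleDeriv_laurentCos, angleDeriv_laurentSin,
    Int.cast_one, neg_smul, one_smul, smul_eq_mul]
  ring

theorem angleDeriv_supportLaurent_one (P : ℂ[T;T⁻¹]) :
    angleDeriv (supportLaurent P 1) = (P + angleDeriv (angleDeriv P)) * laurentCos 1 := by
  change angleDeriv (P * laurentSin 1 + angleDeriv P * laurentCos 1) = _
  simp only [map_add, Derivation.leibniz, angleDeriv_laurentCos, angleDeriv_laurentSin,
    Int.cast_one, neg_smul, one_smul, smul_eq_mul]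
  ring

theorem toRatFunc_aeval_mem_adjoin {k σ : Type*} [Field k] (v : σ → k[T;T⁻¹])
    (g : MvPolynomial σ k) :
    toRatFunc k (aeval v g) ∈
      IntermediateField.adjoin k (Set.range fun i => toRatFunc k (v i)) := by
  rw [comp_aeval_apply]
  refine IntermediateField.algebra_adjoin_le_adjoin k _ ?_
  rw [Algebra.adjoin_range_eq_range_aeval]
  exact AlgHom.mem_range_self _ g

theorem laurentCos_add_I_smul_laurentSin (j : ℤ) :
    laurentCos j + Complex.I • laurentSin j = T j := by
  simp only [laurentCos, laurentSin]
  match_scalars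
  · linear_combination (-1 / 2 : ℂ) * Complex.I_mul_I
  · linear_combination (1 / 2 : ℂ) * Complex.I_mul_I

theorem laurentCos_sub_I_smul_laurentSin (j : ℤ) :
    laurentCos j - Complex.I • laurentSin j = T (-j) := by
  simp only [laurentCos, laurentSin]
  match_scalars
  · linear_combination (1 / 2 : ℂ) * Complex.I_mul_I
  · linear_combination (-1 / 2 : ℂ) * Complex.I_mul_I

theorem aeval_pderiv_supportLaurent {P : ℂ[T;T⁻¹]} (hW : P + angleDeriv (angleDeriv P) ≠ 0)
    {f : MvPolynomial (Fin 2) ℂ} (hf : aeval (supportLaurent P) f = 0) :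
    aeval (supportLaurent P) (pderiv 0 f) * laurentSin 1
      = aeval (supportLaurent P) (pderiv 1 f) * laurentCos 1 := by
  have hchain := derivation_aeval angleDeriv (supportLaurent P) f
  rw [hf, map_zero, Fin.sum_univ_two, angleDeriv_supportLaurent_zero,
    angleDeriv_supportLaurent_one, smul_eq_mul, smul_eq_mul] at hchain
  exact mul_left_cancel₀ hW (by linear_combination hchain)

theorem X_sq_mem_of_eq_T_two_mul {k : Type*} [Field k] {S : IntermediateField k (RatFunc k)}
    {q r : k[T;T⁻¹]} (hq : toRatFunc k q ∈ S) (hr : toRatFunc k r ∈ S) (hr0 : r ≠ 0)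
    (h : q = T 2 * r) : RatFunc.X ^ 2 ∈ S := by
  have hr0' : toRatFunc k r ≠ 0 := (map_ne_zero_iff _ toRatFunc_injective).2 hr0
  have hX : RatFunc.X ^ 2 = toRatFunc k q / toRatFunc k r := by
    rw [eq_div_iff hr0', h, map_mul, toRatFunc_T, zpow_ofNat]
  exact hX ▸ div_mem hq hr

-- A solution `(A, B)` is a multiple `c (cos θ, sin θ)` of the normal direction, and
-- `c exp (± i θ)` are its isotropic coordinates `A ± i B`.
theorem add_I_smul_eq_T_two_mul {A B : ℂ[T;T⁻¹]} (h : A * laurentSin 1 = B * laurentCos 1) :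
    A + Complex.I • B = T 2 * (A - Complex.I • B) := by
  have hinv : (T 1 * T (-1) : ℂ[T;T⁻¹]) = 1 := by
    rw [← T_add, add_neg_cancel, T_zero]
  have hcross : T (-1) * (A + Complex.I • B) = T 1 * (A - Complex.I • B) := by
    rw [← laurentCos_sub_I_smul_laurentSin, ← laurentCos_add_I_smul_laurentSin]
    simp only [Algebra.smul_def]
    linear_combination (-2 * algebraMap ℂ ℂ[T;T⁻¹] Complex.I) * h
  calc A + Complex.I • B = T 1 * (T (-1) * (A + Complex.I • B)) := by
        rw [← mul_assoc, hinv, one_mul]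
    _ = T 2 * (A - Complex.I • B) := by
        rw [hcross, ← mul_assoc, ← T_add, one_add_one_eq_two]

theorem eq_zero_of_sub_I_smul_eq_zero {A B : ℂ[T;T⁻¹]}
    (h : A * laurentSin 1 = B * laurentCos 1) (hsub : A - Complex.I • B = 0) :
    A = 0 ∧ B = 0 := by
  have hadd : A + Complex.I • B = 0 := by rw [add_I_smul_eq_T_two_mul h, hsub, mul_zero]
  have hA : A = 0 := by
    refine (smul_eq_zero_iff_right (two_ne_zero : (2 : ℂ) ≠ 0)).1 ?_
    rw [two_smul]
    linear_combination hadd + hsub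
  rw [hA, zero_add, smul_eq_zero_iff_right Complex.I_ne_zero] at hadd
  exact ⟨hA, hadd⟩

theorem X_sq_mem_adjoin_supportLaurent {P : ℂ[T;T⁻¹]} (hW : P + angleDeriv (angleDeriv P) ≠ 0)
    {f : MvPolynomial (Fin 2) ℂ} (hf : aeval (supportLaurent P) f = 0) {i : Fin 2}
    (hi : aeval (supportLaurent P) (pderiv i f) ≠ 0) :
    RatFunc.X ^ 2 ∈
      IntermediateField.adjoin ℂ (Set.range fun i => toRatFunc ℂ (supportLaurent P i)) := by
  have hcross := aeval_pderiv_supportLaurent hW hf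
  have hmem (i : Fin 2) := toRatFunc_aeval_mem_adjoin (supportLaurent P) (pderiv i f)
  set S := IntermediateField.adjoin ℂ (Set.range fun i => toRatFunc ℂ (supportLaurent P i))
  have hgrad : ¬ (aeval (supportLaurent P) (pderiv 0 f) = 0 ∧
      aeval (supportLaurent P) (pderiv 1 f) = 0) := by
    rintro ⟨h0, h1⟩
    fin_cases i
    exacts [hi h0, hi h1]
  have hA := hmem 0
  have hB := hmem 1
  generalize aeval (supportLaurent P) (pderiv 0 f) = A at hcross hgrad hA
  generalize aeval (supportLaurent P) (pderiv 1 f) = B at hcross hgrad hB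
  have hIB : toRatFunc ℂ (Complex.I • B) ∈ S := by
    rw [map_smul]
    exact S.smul_mem hB
  refine X_sq_mem_of_eq_T_two_mul (map_add (toRatFunc ℂ) A _ ▸ add_mem hA hIB)
    (map_sub (toRatFunc ℂ) A _ ▸ sub_mem hA hIB) ?_ (add_I_smul_eq_T_two_mul hcross)
  exact fun hsub => hgrad (eq_zero_of_sub_I_smul_eq_zero hcross hsub)

theorem adjoin_supportLaurent_eq_top {P : ℂ[T;T⁻¹]} {j : ℤ} (hj : Even j) (hPj : P.coeff j ≠ 0)
    (hsq : RatFunc.X ^ 2 ∈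
      IntermediateField.adjoin ℂ (Set.range fun i => toRatFunc ℂ (supportLaurent P i))) :
    IntermediateField.adjoin ℂ (Set.range fun i => toRatFunc ℂ (supportLaurent P i)) = ⊤ := by
  set S := IntermediateField.adjoin ℂ (Set.range fun i => toRatFunc ℂ (supportLaurent P i))
  have hgen (i : Fin 2) : toRatFunc ℂ (supportLaurent P i) ∈ S :=
    IntermediateField.subset_adjoin _ _ ⟨i, rfl⟩
  have hU : toRatFunc ℂ (supportLaurent P 0 + Complex.I • supportLaurent P 1) ∈ S := by
    rw [map_add, map_smul]
    exact add_mem (hgen 0) (S.smul_mem (hgen 1))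
  have hcoeff : (supportLaurent P 0 + Complex.I • supportLaurent P 1).coeff (j + 1)
      = (1 - j) * P.coeff j := by
    rw [AddMonoidAlgebra.coeff_add, Finsupp.add_apply, AddMonoidAlgebra.coeff_smul,
      Finsupp.smul_apply, coeff_supportLaurent_zero, coeff_supportLaurent_one,
      add_sub_cancel_right, smul_eq_mul]
    push_cast
    linear_combination (-1 / 2 : ℂ) * ((1 - j) * P.coeff j - (3 + j) * P.coeff (j + 1 + 1))
      * Complex.I_mul_I
  have hj1 : (1 - j : ℂ) ≠ 0 := sub_ne_zero.2 fun h => by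
    rw [← (by exact_mod_cast h : (1 : ℤ) = j)] at hj
    exact Int.not_even_one hj
  have hX := X_mem_of_X_sq_mem hsq hU hj.add_one (hcoeff ▸ mul_ne_zero hj1 hPj)
  rw [eq_top_iff, ← RatFunc.adjoin_X]
  exact IntermediateField.adjoin_le_iff.2 (Set.singleton_subset_iff.2 hX)

theorem add_angleDeriv_angleDeriv_ne_zero {P : ℂ[T;T⁻¹]} {N : ℕ} (hN : N ≠ 1)
    (hP : P.coeff N ≠ 0) : P + angleDeriv (angleDeriv P) ≠ 0 := by
  have hcoeff : (P + angleDeriv (angleDeriv P)).coeff N = (1 - N ^ 2) * P.coeff N := by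
    rw [AddMonoidAlgebra.coeff_add, Finsupp.add_apply, coeff_angleDeriv, coeff_angleDeriv]
    push_cast
    linear_combination (N : ℂ) ^ 2 * P.coeff N * Complex.I_mul_I
  have hN' : (1 - N ^ 2 : ℂ) ≠ 0 := sub_ne_zero.2 fun h => by
    have hsq : N ^ 2 = 1 := by exact_mod_cast h.symm
    exact hN (by nlinarith)
  intro h
  exact mul_ne_zero hN' hP (hcoeff ▸ by rw [h]; rfl)

section supportCurve

variable {p : ℝ → ℝ} {P : ℂ[T;T⁻¹]} {N : ℕ} {j : ℤ} {f : MvPolynomial (Fin 2) ℝ}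

theorem exists_isDefiningPolynomial_supportCurve (hp : ∀ θ, (p θ : ℂ) = evalCircle θ P)
    (hN : N ≠ 1) (hP : HasTwoSidedDegree P N) : ∃ f, IsDefiningPolynomial (supportCurve p) f :=
  exists_isDefiningPolynomial_image (ofReal_supportParam hp) N.succ_ne_zero
    (hasTwoSidedDegree_supportLaurent hN hP)

theorem IsDefiningPolynomial.adjoin_supportLaurent_eq_top
    (hp : ∀ θ, (p θ : ℂ) = evalCircle θ P) (hN : N ≠ 1) (hP : HasTwoSidedDegree P N)
    (hj : Even j) (hPj : P.coeff j ≠ 0) (hf : IsDefiningPolynomial (supportCurve p) f) :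
    IntermediateField.adjoin ℂ (Set.range fun i => toRatFunc ℂ (supportLaurent P i)) = ⊤ := by
  have hdvd (g) : aeval (supportLaurent P) (map (algebraMap ℝ ℂ) g) = 0 ↔ f ∣ g := by
    rw [aeval_map_algebraMap]
    exact hf.aeval_eq_zero_iff_dvd (ofReal_supportParam hp)
  obtain ⟨i, hi⟩ := exists_not_dvd_pderiv hf.irreducible
  rw [← hdvd, ← pderiv_map] at hi
  have hW := add_angleDeriv_angleDeriv_ne_zero hN hP.coeff_top_ne_zero
  exact _root_.adjoin_supportLaurent_eq_top hj hPj
    (X_sq_mem_adjoin_supportLaurent hW ((hdvd f).2 dvd_rfl) hi)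

theorem IsDefiningPolynomial.totalDegree_supportCurve_le (hp : ∀ θ, (p θ : ℂ) = evalCircle θ P)
    (hN : N ≠ 1) (hP : HasTwoSidedDegree P N) (hf : IsDefiningPolynomial (supportCurve p) f) :
    f.totalDegree ≤ 2 * (N + 1) :=
  hf.totalDegree_le (ofReal_supportParam hp) fun i =>
    (hasTwoSidedDegree_supportLaurent hN hP i).mem_laurentDegreeLE

theorem IsDefiningPolynomial.degreeOf_supportCurve (hp : ∀ θ, (p θ : ℂ) = evalCircle θ P)
    (hN : N ≠ 1) (hP : HasTwoSidedDegree P N) (hj : Even j) (hPj : P.coeff j ≠ 0)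
    (hf : IsDefiningPolynomial (supportCurve p) f) (i : Fin 2) :
    f.degreeOf i = 2 * (N + 1) :=
  le_antisymm ((degreeOf_le_totalDegree f i).trans (hf.totalDegree_supportCurve_le hp hN hP)) <|
    hf.le_degreeOf (ofReal_supportParam hp) N.succ_ne_zero (hasTwoSidedDegree_supportLaurent hN hP)
      (hf.adjoin_supportLaurent_eq_top hp hN hP hj hPj) i

theorem IsDefiningPolynomial.totalDegree_supportCurve (hp : ∀ θ, (p θ : ℂ) = evalCircle θ P)
    (hN : N ≠ 1) (hP : HasTwoSidedDegree P N) (hj : Even j) (hPj : P.coeff j ≠ 0)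
    (hf : IsDefiningPolynomial (supportCurve p) f) : f.totalDegree = 2 * (N + 1) :=
  le_antisymm (hf.totalDegree_supportCurve_le hp hN hP) <|
    (hf.degreeOf_supportCurve hp hN hP hj hPj 0).ge.trans (degreeOf_le_totalDegree f 0)

end supportCurve

/-- The Laurent polynomial of the harmonic `a cos (j θ) + b sin (j θ)`. -/
noncomputable def laurentHarmonic (a b : ℝ) (j : ℤ) : ℂ[T;T⁻¹] :=
  (a : ℂ) • laurentCos j + (b : ℂ) • laurentSin j

theorem evalCircle_laurentHarmonic (θ a b : ℝ) (j : ℤ) :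
    evalCircle θ (laurentHarmonic a b j)
      = ((a * Real.cos (j * θ) + b * Real.sin (j * θ) : ℝ) : ℂ) := by
  rw [laurentHarmonic, map_add, map_smul, map_smul, evalCircle_laurentCos, evalCircle_laurentSin]
  push_cast
  rfl

theorem coeff_laurentHarmonic (a b : ℝ) (j i : ℤ) :
    (laurentHarmonic a b j).coeff i = (if j = i then (a - b * Complex.I) / 2 else 0)
      + if -j = i then (a + b * Complex.I) / 2 else 0 := by
  simp only [laurentHarmonic, laurentCos, laurentSin, AddMonoidAlgebra.coeff_add,
    AddMonoidAlgebra.coeff_sub, AddMonoidAlgebra.coeff_smul, Finsupp.add_apply, Finsupp.sub_apply,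
    Finsupp.smul_apply, smul_eq_mul, T_apply]
  split_ifs <;> ring

theorem laurentHarmonic_mem_laurentDegreeLE (a b : ℝ) {j : ℤ} {M : ℕ} (hj : |j| ≤ M) :
    laurentHarmonic a b j ∈ laurentDegreeLE ℂ M := by
  have hT : T j ∈ laurentDegreeLE ℂ M := T_mem_laurentDegreeLE hj
  have hT' : T (-j) ∈ laurentDegreeLE ℂ M := T_mem_laurentDegreeLE (by rwa [abs_neg])
  exact add_mem (Submodule.smul_mem _ _ (Submodule.smul_mem _ _ (add_mem hT hT')))
    (Submodule.smul_mem _ _ (Submodule.smul_mem _ _ (sub_mem hT hT')))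

theorem hasTwoSidedDegree_laurentHarmonic {a b : ℝ} (hab : a ≠ 0 ∨ b ≠ 0) {M : ℕ} (hM : M ≠ 0) :
    HasTwoSidedDegree (laurentHarmonic a b M) M := by
  refine ⟨laurentHarmonic_mem_laurentDegreeLE a b (by simp), ?_, ?_⟩
  · rw [coeff_laurentHarmonic, if_pos rfl, if_neg (by omega), add_zero]
    simpa [Complex.ext_iff, imp_iff_not_or] using hab
  · rw [coeff_laurentHarmonic, if_neg (by omega), if_pos rfl, zero_add]
    simpa [Complex.ext_iff, imp_iff_not_or] using hab

theorem hasTwoSidedDegree_add_of_lt {R : Type*} [Semiring R] {q r : R[T;T⁻¹]} {L M : ℕ}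
    (hq : q ∈ laurentDegreeLE R L) (hr : HasTwoSidedDegree r M) (hLM : L < M) :
    HasTwoSidedDegree (q + r) M := by
  have hzero (j : ℤ) (hj : (L : ℤ) < |j|) : (q + r).coeff j = r.coeff j := by
    rw [AddMonoidAlgebra.coeff_add, Finsupp.add_apply, mem_laurentDegreeLE.1 hq j hj, zero_add]
  have hLM' : (L : ℤ) < M := Nat.cast_lt.2 hLM
  refine ⟨add_mem (laurentDegreeLE_mono hLM.le hq) hr.mem_laurentDegreeLE, ?_, ?_⟩
  · rw [hzero _ (by rwa [Nat.abs_cast])]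
    exact hr.coeff_top_ne_zero
  · rw [hzero _ (by rwa [abs_neg, Nat.abs_cast])]
    exact hr.coeff_bot_ne_zero

/-- The Laurent polynomial of `rotorSupport n m ρ a b`. -/
noncomputable def rotorLaurent (n m : ℕ) (ρ : ℝ) (a b : ℤ → ℝ) : ℂ[T;T⁻¹] :=
  (ρ : ℂ) • T 0 + ∑ k ∈ Finset.range (m + 1),
    (laurentHarmonic (a (k * n - 1)) (b (k * n - 1)) (k * n - 1)
      + laurentHarmonic (a (k * n + 1)) (b (k * n + 1)) (k * n + 1))

section rotorLaurent

variable {n m : ℕ} {ρ : ℝ} {a b : ℤ → ℝ}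

theorem ofReal_rotorSupport (θ : ℝ) :
    (rotorSupport n m ρ a b θ : ℂ) = evalCircle θ (rotorLaurent n m ρ a b) := by
  rw [rotorLaurent, rotorSupport, map_add, map_smul, evalCircle_T, map_sum, Complex.ofReal_add,
    Complex.ofReal_sum]
  congr 1
  · simp
  · refine Finset.sum_congr rfl fun k _ => ?_
    rw [map_add, evalCircle_laurentHarmonic, evalCircle_laurentHarmonic, ← Complex.ofReal_add]
    congr 1
    push_cast
    ring

theorem rotorLaurent_mem_laurentDegreeLE :
    rotorLaurent n m ρ a b ∈ laurentDegreeLE ℂ (n * m + 1) := by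
  refine add_mem (Submodule.smul_mem _ _ (T_mem_laurentDegreeLE (by positivity)))
    (sum_mem fun k hk => add_mem ?_ ?_) <;>
  · refine laurentHarmonic_mem_laurentDegreeLE _ _ ?_
    have hkm : (k * n : ℤ) ≤ n * m := by
      rw [mul_comm]
      exact_mod_cast Nat.mul_le_mul_left n (Finset.mem_range_succ_iff.1 hk)
    have hk0 : 0 ≤ (k * n : ℤ) := by positivity
    push_cast
    rw [abs_le]
    omega

theorem hasTwoSidedDegree_rotorLaurent (hn : n ≠ 0) (hm : m ≠ 0)
    (htop : a ((n : ℤ) * m + 1) ≠ 0 ∨ b ((n : ℤ) * m + 1) ≠ 0) :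
    HasTwoSidedDegree (rotorLaurent n m ρ a b) (n * m + 1) := by
  obtain ⟨l, rfl⟩ := Nat.exists_eq_succ_of_ne_zero hm
  have hl : n * l + 1 ≤ n * (l + 1) := by
    rw [mul_add_one]
    omega
  have hlow : rotorLaurent n l ρ a b + laurentHarmonic (a ((l + 1 : ℕ) * n - 1))
      (b ((l + 1 : ℕ) * n - 1)) ((l + 1 : ℕ) * n - 1) ∈ laurentDegreeLE ℂ (n * (l + 1)) := by
    refine add_mem (laurentDegreeLE_mono hl rotorLaurent_mem_laurentDegreeLE)
      (laurentHarmonic_mem_laurentDegreeLE _ _ ?_)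
    have hpos : 0 < ((l + 1 : ℕ) * n : ℤ) := by positivity
    rw [abs_le, Nat.cast_mul, mul_comm (n : ℤ)]
    omega
  have hsplit := hasTwoSidedDegree_add_of_lt hlow
    (hasTwoSidedDegree_laurentHarmonic htop (Nat.succ_ne_zero (n * (l + 1)))) (Nat.lt_succ_self _)
  convert hsplit using 1
  rw [rotorLaurent, Finset.sum_range_succ, rotorLaurent]
  push_cast
  rw [mul_comm ((l : ℤ) + 1) n, add_assoc, add_assoc]

theorem coeff_zero_rotorLaurent (hn : 2 ≤ n) : (rotorLaurent n m ρ a b).coeff 0 = ρ := by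
  have hharmonic (x y : ℝ) {j : ℤ} (hj : j ≠ 0) : (laurentHarmonic x y j).coeff 0 = 0 := by
    rw [coeff_laurentHarmonic, if_neg hj, if_neg (neg_ne_zero.2 hj), add_zero]
  have hndvd : ¬ (n : ℤ) ∣ 1 := fun h => by
    have := Int.le_of_dvd one_pos h
    omega
  have hne_sub (k : ℕ) : (k * n - 1 : ℤ) ≠ 0 := fun h =>
    hndvd ⟨k, by linear_combination -h⟩
  have hne_add (k : ℕ) : (k * n + 1 : ℤ) ≠ 0 := by positivity
  simp [rotorLaurent, AddMonoidAlgebra.coeff_sum, hharmonic, hne_sub, hne_add]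

end rotorLaurent

theorem exists_mem_Icc_cos_eq_sin_eq {x y : ℝ} (h : x ^ 2 + y ^ 2 = 1) :
    ∃ θ ∈ Set.Icc (-Real.pi) Real.pi, Real.cos θ = x ∧ Real.sin θ = y := by
  let z : ℂ := ⟨x, y⟩
  have hz : ‖z‖ = 1 := by rw [Complex.norm_eq_sqrt_sq_add_sq, h, Real.sqrt_one]
  refine ⟨z.arg, ⟨(Complex.neg_pi_lt_arg z).le, Complex.arg_le_pi z⟩, ?_, ?_⟩
  · rw [← one_mul (Real.cos _), ← hz, Complex.norm_mul_cos_arg]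
  · rw [← one_mul (Real.sin _), ← hz, Complex.norm_mul_sin_arg]

theorem isCircle_of_supportParam_eq {p : ℝ → ℝ} {c : Fin 2 → ℝ} {r : ℝ} (hr : r ≠ 0)
    (hp : ∀ θ, supportParam p θ = ![c 0 + r * Real.cos θ, c 1 + r * Real.sin θ]) :
    IsCircle (supportCurve p) := by
  refine ⟨c, |r|, abs_pos.2 hr, ?_⟩
  ext Q
  rw [Set.mem_ofPred_eq, sq_abs]
  constructor
  · rintro ⟨θ, -, rfl⟩
    simp only [hp, Matrix.cons_val_zero, Matrix.cons_val_one]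
    linear_combination r ^ 2 * Real.sin_sq_add_cos_sq θ
  · intro hQ
    obtain ⟨θ, hθ, hcos, hsin⟩ := exists_mem_Icc_cos_eq_sin_eq
      (x := (Q 0 - c 0) / r) (y := (Q 1 - c 1) / r) (by field_simp; exact hQ)
    refine ⟨θ, hθ, ?_⟩
    rw [hp, hcos, hsin, mul_div_cancel₀ _ hr, mul_div_cancel₀ _ hr]
    ext i
    fin_cases i <;> simp

theorem supportParam_rotorSupport_zero (n : ℕ) (ρ : ℝ) (a b : ℤ → ℝ) (θ : ℝ) :
    supportParam (rotorSupport n 0 ρ a b) θ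
      = ![a 1 + a (-1) + ρ * Real.cos θ, b 1 - b (-1) + ρ * Real.sin θ] := by
  have hp : rotorSupport n 0 ρ a b
      = fun θ => ρ + ((a 1 + a (-1)) * Real.cos θ + (b 1 - b (-1)) * Real.sin θ) := by
    ext θ
    simp only [rotorSupport, zero_add, Finset.range_one, Finset.sum_singleton, Nat.cast_zero,
      zero_mul, one_mul, zero_sub, neg_one_mul, Real.cos_neg, Real.sin_neg]
    ring
  have hderiv : deriv (rotorSupport n 0 ρ a b) θ
      = (a 1 + a (-1)) * -Real.sin θ + (b 1 - b (-1)) * Real.cos θ := by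
    rw [hp]
    exact ((((Real.hasDerivAt_cos θ).const_mul _).add
      ((Real.hasDerivAt_sin θ).const_mul _)).const_add ρ).deriv
  have hsq := Real.sin_sq_add_cos_sq θ
  rw [supportParam, hderiv, hp]
  congr 1
  · linear_combination (a 1 + a (-1)) * hsq
  · congr 1
    linear_combination (b 1 - b (-1)) * hsq

theorem isCircle_supportCurve_rotorSupport_zero (n : ℕ) {ρ : ℝ} (hρ : ρ ≠ 0) (a b : ℤ → ℝ) :
    IsCircle (supportCurve (rotorSupport n 0 ρ a b)) :=
  isCircle_of_supportParam_eq (c := ![a 1 + a (-1), b 1 - b (-1)]) hρ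
    (supportParam_rotorSupport_zero n ρ a b)

theorem theorem2p3_general {n m : ℕ} {ρ : ℝ} {a b : ℤ → ℝ} (hn : 2 ≤ n) (hρ : ρ ≠ 0)
    (hcirc : ¬ IsCircle (supportCurve (rotorSupport n m ρ a b)))
    (htop : a ((n : ℤ) * m + 1) ≠ 0 ∨ b ((n : ℤ) * m + 1) ≠ 0) :
    (∃ f, IsDefiningPolynomial (supportCurve (rotorSupport n m ρ a b)) f) ∧
      ∀ f, IsDefiningPolynomial (supportCurve (rotorSupport n m ρ a b)) f →
        f.totalDegree = 2 * n * m + 4 ∧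
        f.degreeOf 0 = 2 * n * m + 4 ∧
        f.degreeOf 1 = 2 * n * m + 4 := by
  have hn0 : n ≠ 0 := by omega
  have hm : m ≠ 0 := by
    rintro rfl
    exact hcirc (isCircle_supportCurve_rotorSupport_zero n hρ a b)
  have hN : n * m + 1 ≠ 1 := by simp [hn0, hm]
  have hdeg : HasTwoSidedDegree (rotorLaurent n m ρ a b) (n * m + 1) :=
    hasTwoSidedDegree_rotorLaurent hn0 hm htop
  have hmean : (rotorLaurent n m ρ a b).coeff 0 ≠ 0 := by
    rwa [coeff_zero_rotorLaurent hn, Complex.ofReal_ne_zero]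
  refine ⟨exists_isDefiningPolynomial_supportCurve ofReal_rotorSupport hN hdeg, fun f hf => ?_⟩
  rw [(by ring : 2 * n * m + 4 = 2 * (n * m + 1 + 1))]
  exact ⟨hf.totalDegree_supportCurve ofReal_rotorSupport hN hdeg Even.zero hmean,
    hf.degreeOf_supportCurve ofReal_rotorSupport hN hdeg Even.zero hmean 0,
    hf.degreeOf_supportCurve ofReal_rotorSupport hN hdeg Even.zero hmean 1⟩

theorem theorem2p3 (n m : ℕ) (ρ : ℝ) (a b : ℤ → ℝ) (C : Set (Fin 2 → ℝ))
    (hC : IsAlgebraicRotor n m ρ a b C) (hcirc : ¬ IsCircle C)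
    (htop : a ((n : ℤ) * m + 1) ≠ 0 ∨ b ((n : ℤ) * m + 1) ≠ 0) :
    (∃ f : MvPolynomial (Fin 2) ℝ, IsDefiningPolynomial C f) ∧
      ∀ f : MvPolynomial (Fin 2) ℝ, IsDefiningPolynomial C f →
        f.totalDegree = 2 * n * m + 4 ∧
        f.degreeOf 0 = 2 * n * m + 4 ∧
        f.degreeOf 1 = 2 * n * m + 4 := by
  obtain ⟨hn, hρ, rfl, -⟩ := hC
  exact theorem2p3_general (Nat.le_of_succ_le hn) hρ.ne' hcirc htop
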